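/- **Theorem (Completeness of $\Lambda$ with respect to Kripke-estit models).** Let $Ags$ be a finite set of agent names and $P$ a countable set of propositional letters. Formulas are given by $$\phi ::= p \mid \neg\phi \mid \phi\wedge\phi \mid \Box\phi \mid [\alpha]\phi \mid K_\alpha\phi \mid \odot[\alpha]\phi \mid \odot_{\mathcal S}[\alpha]\phi\qquad (p\in P,\ \alpha\in Ags),$$ with $\Diamond\phi:=\neg\Box\neg\phi$ and the usual abbreviations $\to,\vee$. *Proof system.* $\Lambda$ has as axioms all classical tautologies, the $\mathbf{S5}$ schemata (K), (T), (4), (5) for each of $\Box,[\alpha],K_\alpha$, and the schemata - (A1) $\odot[\alpha](p\to q)\to(\odot[\alpha]p\to\odot[\alpha]q)$; (A2) $\Box p\to[\alpha]p\wedge\odot[\alpha]p$; (A3) $\Box\odot[\alpha]p\vee\Box\neg\odot[\alpha]p$; (A4) $\odot[\alpha]p\to\odot[\alpha]([\alpha]p)$; (Oic) $\odot[\alpha]p\to\Diamond[\alpha]p$; - (IA) $\bigwedge_{1\le i\le n}\Diamond[\alpha_i]p_i\to\Diamond\bigwedge_{1\le i\le n}[\alpha_i]p_i$ for $n\ge 1$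 and pairwise different $\alpha_1,\dots,\alpha_n$; - (A5) $\odot_{\mathcal S}[\alpha](p\to q)\to(\odot_{\mathcal S}[\alpha]p\to\odot_{\mathcal S}[\alpha]q)$; (A6) $\odot_{\mathcal S}[\alpha]p\to\odot_{\mathcal S}[\alpha](K_\alpha p)$; (OAC) $K_\alpha p\to[\alpha]p$; (Unif-H) $\Diamond K_\alpha p\to K_\alpha\Diamond p$; (s.N) $K_\alpha\Box p\to\odot_{\mathcal S}[\alpha]p$; (s.Oic) $\odot_{\mathcal S}[\alpha]p\to\Diamond K_\alpha p$; (Cl) $\odot_{\mathcal S}[\alpha]p\to K_\alpha\Box\odot_{\mathcal S}[\alpha]p$; its rules are Modus Ponens, Substitution, and Necessitation for each of $\Box,[\alpha],K_\alpha,\odot[\alpha],\odot_{\mathcal S}[\alpha]$. Write $\vdash_\Lambda\phi$ if $\phi$ is a theorem, and call $\phi$ $\Lambda$-consistent if $\nvdash_\Lambda\neg\phi$. *Models.* A Kripke-estit model consists of a set $W$ of worlds, a valuation $\mathcal V:P\to 2^W$, and 1. an equivalence relation $R_\Box$ on $W$, with classes $\overline w$; 2. for each $\alpha\in Ags$ and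 each class $\overline w$, a partition $\mathtt{Choice}_\alpha^{\overline w}$ of $\overline w$ such that (independence of agency) $\bigcap_{\alpha\in Ags}s(\alpha)\neq\emptyset$ for every selection function $s$ at $\overline w$, i.e. every $s$ with $s(\alpha)\in\mathtt{Choice}_\alpha^{\overline w}$ for all $\alpha$ (an empty intersection being $\overline w$); the cell of $v\in\overline w$ is $\mathtt{Choice}_\alpha^{\overline w}(v)$; 3. for each $\alpha\in Ags$ an equivalence relation $\approx_\alpha$ on $W$ such that (own action) if $v\approx_\alpha u$ and $v'\in\mathtt{Choice}_\alpha^{\overline v}(v)$ then $v'\approx_\alpha u$, and (uniformity) if $v\approx_\alpha u$ for some $v\in\overline{w_1}$, $u\in\overline{w_2}$, then for every $v'\in\overline{w_1}$ there is $u'\in\overline{w_2}$ with $v'\approx_\alpha u'$; 4. two functions $\mathtt{Value}_{\mathcal O},\mathtt{Value}_{\mathcal S}:W\to\mathbb R$. Put $\mathtt{State}_\beta^{\overline w}=\{\overline w\cap\bigcap_{\alpha\in Ags\setminus\{\beta\}}s(\alpha) : s \text{ a selection function at }\overline w\}$. For $X,Y\subseteq W$ let $X\le Y$ (resp. $X\le_s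 Y$) mean $\mathtt{Value}_{\mathcal O}(x)\le\mathtt{Value}_{\mathcal O}(y)$ (resp. $\mathtt{Value}_{\mathcal S}(x)\le\mathtt{Value}_{\mathcal S}(y)$) for all $x\in X$, $y\in Y$. Write $\overline w\sim_\alpha\overline{w'}$ if $v\approx_\alpha u$ for some $v\in\overline w$, $u\in\overline{w'}$, and $[\![L]\!]_\alpha^{\overline{w'}}=\{u\in\overline{w'}:\exists o\in L,\ o\approx_\alpha u\}$. For $L,L'\in\mathtt{Choice}_\alpha^{\overline w}$ let $L\preceq L'$ iff $L\cap S\le L'\cap S$ for all $S\in\mathtt{State}_\alpha^{\overline w}$; let $L\preceq_s L'$ iff $[\![L]\!]_\alpha^{\overline{w'}}\cap S\le_s[\![L']\!]_\alpha^{\overline{w'}}\cap S$ for all $\overline{w'}$ with $\overline w\sim_\alpha\overline{w'}$ and all $S\in\mathtt{State}_\alpha^{\overline{w'}}$; let $L\prec L'$ iff $L\preceq L'$ and $L'\not\preceq L$, and similarly for $\prec_s$. *Truth.* $w\Vdash p$ iff $w\in\mathcal V(p)$; $\neg,\wedge$ are Boolean; $w\Vdash\Box\phi$, $w\Vdash[\alpha]\phi$,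 $w\Vdash K_\alpha\phi$ iff $\phi$ holds at all $v\in\overline w$, at all $v\in\mathtt{Choice}_\alpha^{\overline w}(w)$, at all $v$ with $w\approx_\alpha v$, respectively; and - $w\Vdash\odot[\alpha]\phi$ iff for every $L\in\mathtt{Choice}_\alpha^{\overline w}$ that contains a world where $\phi$ fails there is $L'\in\mathtt{Choice}_\alpha^{\overline w}$ with $L\prec L'$ such that for every $L''\in\mathtt{Choice}_\alpha^{\overline w}$ with $L''=L'$ or $L'\preceq L''$, $\phi$ holds throughout $L''$; - $w\Vdash\odot_{\mathcal S}[\alpha]\phi$ iff for every $L\in\mathtt{Choice}_\alpha^{\overline w}$ such that $\phi$ fails somewhere in $[\![L]\!]_\alpha^{\overline{w'}}$ for some $\overline{w'}$ with $\overline w\sim_\alpha\overline{w'}$, there is $L'\in\mathtt{Choice}_\alpha^{\overline w}$ with $L\prec_s L'$ such that for every $L''\in\mathtt{Choice}_\alpha^{\overline w}$ with $L''=L'$ or $L'\preceq_s L''$, $\phi$ holds throughout $[\![L'']\!]_\alpha^{\overline{w''}}$ for every $\overline{w''}$ with $\overline w\sim_\alpha\overline{w''}$. *Claim.* $\Lambda$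 is complete with respect to the class of Kripke-estit models: every formula that is true at every world of every Kripke-estit model is a theorem of $\Lambda$; equivalently, every $\Lambda$-consistent formula is true at some world of some Kripke-estit model. -/

import Mathlib

universe u v w

namespace Estit

/-! ### Syntax -/

/-- Formulas over agent names `Ags` and propositional letters `P`. -/
inductive Formula (Ags : Type u) (P : Type v) : Type (max u v) where
  | atom : P → Formula Ags P
  | neg : Formula Ags P → Formula Ags P
  | conj : Formula Ags P → Formula Ags P → Formula Ags P
  /-- historical necessity -/
  | box : Formula Ags P → Formula Ags P
  /-- the agent sees to it that -/
  | stit : Ags → Formula Ags P → Formula Ags P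
  /-- the agent knows that -/
  | know : Ags → Formula Ags P → Formula Ags P
  /-- the agent objectively ought to see to it that -/
  | ought : Ags → Formula Ags P → Formula Ags P
  /-- the agent subjectively ought to see to it that -/
  | oughtS : Ags → Formula Ags P → Formula Ags P

namespace Formula

variable {Ags : Type u} {P : Type v}

/-- Material implication. -/
def imp (φ ψ : Formula Ags P) : Formula Ags P := neg (conj φ (neg ψ))

/-- Disjunction. -/
def disj (φ ψ : Formula Ags P) : Formula Ags P := neg (conj (neg φ) (neg ψ))

/-- Historical possibility, the dual of `box`. -/
def dia (φ : Formula Ags P) : Formula Ags P := neg (box (neg φ))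

/-- The conjunction of the nonempty list `φ :: l`. -/
def bigConj : Formula Ags P → List (Formula Ags P) → Formula Ags P
  | φ, [] => φ
  | φ, ψ :: l => conj φ (bigConj ψ l)

/-- Uniform substitution of formulas for propositional letters. -/
def subst (σ : P → Formula Ags P) : Formula Ags P → Formula Ags P
  | atom p => σ p
  | neg φ => neg (subst σ φ)
  | conj φ ψ => conj (subst σ φ) (subst σ ψ)
  | box φ => box (subst σ φ)
  | stit α φ => stit α (subst σ φ)
  | know α φ => know α (subst σ φ)
  | ought α φ => ought α (subst σ φ)
  | oughtS α φ => oughtS α (subst σ φ)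

/-- Classical tautologies: formulas true under every assignment of truth values to formulas that
respects the Boolean connectives (and is arbitrary on letters and on modal formulas). -/
def IsTautology (φ : Formula Ags P) : Prop :=
  ∀ t : Formula Ags P → Prop,
    (∀ ψ, t (neg ψ) ↔ ¬ t ψ) → (∀ ψ χ, t (conj ψ χ) ↔ (t ψ ∧ t χ)) → t φ

end Formula

open Formula

/-! ### The proof system `Λ` -/

/-- The `S5` axiom schemata `(K)`, `(T)`, `(4)`, `(5)` for a unary operator `N`, whose dual is
`fun φ => neg (N (neg φ))`. -/
inductive S5Axiom {Ags : Type u} {P : Type v} (N : Formula Ags P → Formula Ags P) :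
    Formula Ags P → Prop where
  | k (φ ψ : Formula Ags P) : S5Axiom N (imp (N (imp φ ψ)) (imp (N φ) (N ψ)))
  | t (φ : Formula Ags P) : S5Axiom N (imp (N φ) φ)
  | four (φ : Formula Ags P) : S5Axiom N (imp (N φ) (N (N φ)))
  | five (φ : Formula Ags P) : S5Axiom N (imp (neg (N (neg φ))) (N (neg (N (neg φ)))))

/-- Axioms of `Λ`. -/
inductive Axm {Ags : Type u} {P : Type v} : Formula Ags P → Prop where
  | taut (φ : Formula Ags P) : IsTautology φ → Axm φ
  | s5Box (φ : Formula Ags P) : S5Axiom box φ → Axm φ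
  | s5Stit (α : Ags) (φ : Formula Ags P) : S5Axiom (stit α) φ → Axm φ
  | s5Know (α : Ags) (φ : Formula Ags P) : S5Axiom (know α) φ → Axm φ
  | a1 (α : Ags) (φ ψ : Formula Ags P) :
      Axm (imp (ought α (imp φ ψ)) (imp (ought α φ) (ought α ψ)))
  | a2 (α : Ags) (φ : Formula Ags P) : Axm (imp (box φ) (conj (stit α φ) (ought α φ)))
  | a3 (α : Ags) (φ : Formula Ags P) : Axm (disj (box (ought α φ)) (box (neg (ought α φ))))
  | a4 (α : Ags) (φ : Formula Ags P) : Axm (imp (ought α φ) (ought α (stit α φ)))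
  | oic (α : Ags) (φ : Formula Ags P) : Axm (imp (ought α φ) (dia (stit α φ)))
  /-- Independence of agency, for a nonempty list of pairs of an agent and a formula in which the
  agents are pairwise different. -/
  | ia (a : Ags × Formula Ags P) (l : List (Ags × Formula Ags P)) :
      ((a :: l).map Prod.fst).Nodup →
      Axm (imp
        (bigConj (dia (stit a.1 a.2)) (l.map fun b => dia (stit b.1 b.2)))
        (dia (bigConj (stit a.1 a.2) (l.map fun b => stit b.1 b.2))))
  | a5 (α : Ags) (φ ψ : Formula Ags P) :
      Axm (imp (oughtS α (imp φ ψ)) (imp (oughtS α φ) (oughtS α ψ)))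
  | a6 (α : Ags) (φ : Formula Ags P) : Axm (imp (oughtS α φ) (oughtS α (know α φ)))
  | oac (α : Ags) (φ : Formula Ags P) : Axm (imp (know α φ) (stit α φ))
  | unifH (α : Ags) (φ : Formula Ags P) : Axm (imp (dia (know α φ)) (know α (dia φ)))
  | sN (α : Ags) (φ : Formula Ags P) : Axm (imp (know α (box φ)) (oughtS α φ))
  | sOic (α : Ags) (φ : Formula Ags P) : Axm (imp (oughtS α φ) (dia (know α φ)))
  | cl (α : Ags) (φ : Formula Ags P) : Axm (imp (oughtS α φ) (know α (box (oughtS α φ))))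

/-- Theorems of `Λ`. -/
inductive Provable {Ags : Type u} {P : Type v} : Formula Ags P → Prop where
  | ax (φ : Formula Ags P) : Axm φ → Provable φ
  | mp (φ ψ : Formula Ags P) : Provable (imp φ ψ) → Provable φ → Provable ψ
  | substitution (σ : P → Formula Ags P) (φ : Formula Ags P) :
      Provable φ → Provable (subst σ φ)
  | necBox (φ : Formula Ags P) : Provable φ → Provable (box φ)
  | necStit (α : Ags) (φ : Formula Ags P) : Provable φ → Provable (stit α φ)
  | necKnow (α : Ags) (φ : Formula Ags P) : Provable φ → Provable (know α φ)
  | necOught (α : Ags) (φ : Formula Ags P) : Provable φ → Provable (ought α φ)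
  | necOughtS (α : Ags) (φ : Formula Ags P) : Provable φ → Provable (oughtS α φ)

/-- A formula is `Λ`-consistent if its negation is not a theorem of `Λ`. -/
def Consistent {Ags : Type u} {P : Type v} (φ : Formula Ags P) : Prop :=
  ¬ Provable (neg φ)

/-! ### Kripke-estit frames and models -/

/-- Kripke-estit frames with set of worlds `W`. A family of equivalence relations, one on each
`rBox`-class, is the same as one equivalence relation on `W` that is contained in `rBox`; so the
choice partitions of agent `α` are given by the single relation `rChoice α`. -/
structure Frame (Ags : Type u) (W : Type w) where
  rBox : W → W → Prop
  rBox_equiv : Equivalence rBox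
  rChoice : Ags → W → W → Prop
  rChoice_equiv : ∀ α, Equivalence (rChoice α)
  rChoice_le : ∀ α v v', rChoice α v v' → rBox v v'
  /-- Independence of agency: whenever every agent is assigned one of the cells of its partition
  of the `rBox`-class of a world `x`, the assigned cells have a common element. -/
  indep : ∀ (x : W) (s : Ags → Set W),
    (∀ α, ∃ v, rBox x v ∧ s α = {u | rChoice α v u}) → (⋂ α, s α).Nonempty
  /-- Epistemic indistinguishability. -/
  eps : Ags → W → W → Prop
  eps_equiv : ∀ α, Equivalence (eps α)
  /-- Own action condition. -/
  oac : ∀ α v u, eps α v u → ∀ v', rChoice α v v' → eps α v' u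
  /-- Uniformity of historical possibility. -/
  unifH : ∀ α x y, (∃ v u, rBox x v ∧ rBox y u ∧ eps α v u) →
    ∀ v', rBox x v' → ∃ u', rBox y u' ∧ eps α v' u'
  valueO : W → ℝ
  valueS : W → ℝ

namespace Frame

variable {Ags : Type u} {W : Type w} (F : Frame Ags W)

/-- The `rBox`-class of `x`. -/
def cls (x : W) : Set W := {v | F.rBox x v}

/-- The choice cell of agent `α` to which the world `v` belongs. -/
def cell (α : Ags) (v : W) : Set W := {u | F.rChoice α v u}

/-- The partition of the class of `x` into the actions available to `α`. -/
def Choice (α : Ags) (x : W) : Set (Set W) := {L | ∃ v ∈ F.cls x, L = F.cell α v}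

/-- The selection functions at the class of `x`. -/
def Select (x : W) : Set (Ags → Set W) := {s | ∀ α, s α ∈ F.Choice α x}

/-- The states that agent `β` faces at the class of `x`: intersections, within that class, of the
actions selected for the agents other than `β`. -/
def State (β : Ags) (x : W) : Set (Set W) :=
  {S | ∃ s ∈ F.Select x, S = {v | v ∈ F.cls x ∧ ∀ α, α ≠ β → v ∈ s α}}

/-- `X ≤ Y` with respect to the objective values. -/
def LeO (X Y : Set W) : Prop := ∀ h ∈ X, ∀ h' ∈ Y, F.valueO h ≤ F.valueO h'

/-- `X ≤ Y` with respect to the subjective values. -/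
def LeS (X Y : Set W) : Prop := ∀ h ∈ X, ∀ h' ∈ Y, F.valueS h ≤ F.valueS h'

/-- Objective weak dominance of actions of `α` at the class of `x`. -/
def DomO (α : Ags) (x : W) (L L' : Set W) : Prop :=
  ∀ S ∈ F.State α x, F.LeO (L ∩ S) (L' ∩ S)

/-- Objective strict dominance. -/
def SDomO (α : Ags) (x : W) (L L' : Set W) : Prop :=
  F.DomO α x L L' ∧ ¬ F.DomO α x L' L

/-- The classes of `x` and `y` are indistinguishable for `α`: some world in the one is
indistinguishable from some world in the other. -/
def Indist (α : Ags) (x y : W) : Prop := ∃ v ∈ F.cls x, ∃ u ∈ F.cls y, F.eps α v u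

/-- The epistemic cluster of `L` at the class of `y`. -/
def cluster (α : Ags) (L : Set W) (y : W) : Set W :=
  {u | u ∈ F.cls y ∧ ∃ o ∈ L, F.eps α o u}

/-- Subjective weak dominance of actions of `α` at the class of `x`. -/
def DomS (α : Ags) (x : W) (L L' : Set W) : Prop :=
  ∀ y, F.Indist α x y → ∀ S ∈ F.State α y,
    F.LeS (F.cluster α L y ∩ S) (F.cluster α L' y ∩ S)

/-- Subjective strict dominance. -/
def SDomS (α : Ags) (x : W) (L L' : Set W) : Prop :=
  F.DomS α x L L' ∧ ¬ F.DomS α x L' L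

end Frame

/-- Kripke-estit models: frames with a valuation. -/
structure Model (Ags : Type u) (P : Type v) (W : Type w) extends Frame Ags W where
  val : P → Set W

/-- Truth of a formula at a world of a Kripke-estit model. -/
def Model.Sat {Ags : Type u} {P : Type v} {W : Type w} (M : Model Ags P W) :
    W → Formula Ags P → Prop
  | x, atom p => x ∈ M.val p
  | x, neg φ => ¬ M.Sat x φ
  | x, conj φ ψ => M.Sat x φ ∧ M.Sat x ψ
  | x, box φ => ∀ v ∈ M.cls x, M.Sat v φ
  | x, stit α φ => ∀ v ∈ M.cell α x, M.Sat v φ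
  | x, know α φ => ∀ v, M.eps α x v → M.Sat v φ
  | x, ought α φ =>
      ∀ L ∈ M.Choice α x, (∃ v ∈ L, ¬ M.Sat v φ) →
        ∃ L' ∈ M.Choice α x, M.SDomO α x L L' ∧
          ∀ L'' ∈ M.Choice α x, (L'' = L' ∨ M.DomO α x L' L'') → ∀ v ∈ L'', M.Sat v φ
  | x, oughtS α φ =>
      ∀ L ∈ M.Choice α x,
        (∃ y, M.Indist α x y ∧ ∃ v ∈ M.cluster α L y, ¬ M.Sat v φ) →
        ∃ L' ∈ M.Choice α x, M.SDomS α x L L' ∧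
          ∀ L'' ∈ M.Choice α x, (L'' = L' ∨ M.DomS α x L' L'') →
            ∀ y, M.Indist α x y → ∀ v ∈ M.cluster α L'' y, M.Sat v φ

/-- `φ` is valid on the class of Kripke-estit models. -/
def Valid {Ags : Type u} {P : Type v} (φ : Formula Ags P) : Prop :=
  ∀ (W : Type (max u v)) (M : Model Ags P W) (x : W), M.Sat x φ

/-- `φ` is satisfiable in a Kripke-estit model. -/
def Satisfiable {Ags : Type u} {P : Type v} (φ : Formula Ags P) : Prop :=
  ∃ (W : Type (max u v)) (M : Model Ags P W) (x : W), M.Sat x φ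

end Estit

/-! The canonical model on maximal consistent sets is already a Kripke-estit model; only the two
value functions have to be invented. Call a world ideal for `α` if every obligation of `α` that
holds there is fulfilled there. By (A3), resp. (Cl), obligations are constant along the relevant
classes, so `α` ought to see to `φ` iff `φ` holds at all ideal worlds of the class, resp. of the
classes that `α` cannot distinguish from it (`ought_mem_iff`, `oughtS_mem_iff`). By (A4) and (A6)
the ideal worlds form a union of choice cells, resp. of epistemic classes; by (Oic) and (s.Oic)
every class contains one.

The value of a world is the number of agents for which it is ideal. A state of `α` fixes the cells
of all other agents, hence their contribution to the count, so inside a state values compare as the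
ideality of `α` alone does (`ncard_le_iff`). Dominance thus has two tiers: ideal actions are the
best ones and strictly dominate the rest. The dominance clauses for the obligations then reduce to
truth at all ideal worlds (`sat_ought_iff`, `sat_oughtS_iff`), which is the missing case of the
truth lemma. -/

namespace Estit

open Formula

/-! ### Theories, derivability and maximal consistent sets -/

section Syntactic

variable {Ags : Type u} {P : Type v}

/-- A set of formulas that contains all theorems and is closed under Modus Ponens. -/
structure IsTheory (T : Set (Formula Ags P)) : Prop where
  prov : ∀ φ, Provable φ → φ ∈ T
  mp : ∀ φ ψ, imp φ ψ ∈ T → φ ∈ T → ψ ∈ T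

/-- The theory generated by a set of formulas. -/
inductive Der (Γ : Set (Formula Ags P)) : Formula Ags P → Prop where
  | mem (φ : Formula Ags P) : φ ∈ Γ → Der Γ φ
  | prov (φ : Formula Ags P) : Provable φ → Der Γ φ
  | mp (φ ψ : Formula Ags P) : Der Γ (imp φ ψ) → Der Γ φ → Der Γ ψ

theorem provable_of_tautology {φ : Formula Ags P} (h : IsTautology φ) : Provable φ :=
  .ax _ (.taut _ h)

theorem IsTheory.mem_of_der {T : Set (Formula Ags P)} (hT : IsTheory T) {φ : Formula Ags P}
    (h : Der T φ) : φ ∈ T := by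
  induction h with
  | mem φ h => exact h
  | prov φ h => exact hT.prov _ h
  | mp φ ψ _ _ h₁ h₂ => exact hT.mp _ _ h₁ h₂

theorem Der.mono {Γ Δ : Set (Formula Ags P)} (hΓ : Γ ⊆ Δ) {φ : Formula Ags P}
    (h : Der Γ φ) : Der Δ φ := by
  induction h with
  | mem φ h => exact .mem _ (hΓ h)
  | prov φ h => exact .prov _ h
  | mp φ ψ _ _ h₁ h₂ => exact .mp _ _ h₁ h₂

/-- Modus Ponens is the only rule that acts on premises; Necessitation and Substitution are confined
to theorems, so nothing obstructs discharging `ψ`. -/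
theorem Der.deduction {Γ : Set (Formula Ags P)} {ψ φ : Formula Ags P}
    (h : Der (insert ψ Γ) φ) : Der Γ (imp ψ φ) := by
  have weaken : ∀ χ : Formula Ags P, Der Γ χ → Der Γ (imp ψ χ) := fun χ hχ =>
    .mp _ _ (.prov _ (provable_of_tautology
      (by intro t hn hc; simp only [imp, hn, hc]; tauto))) hχ
  induction h with
  | mem φ h =>
    rcases h with rfl | h
    · exact .prov _ (provable_of_tautology (by intro t hn hc; simp only [imp, hn, hc]; tauto))
    · exact weaken _ (.mem _ h)
  | prov φ h => exact weaken _ (.prov _ h)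
  | mp φ χ _ _ h₁ h₂ =>
    have taut : Provable (imp (imp ψ (imp φ χ)) (imp (imp ψ φ) (imp ψ χ))) :=
      provable_of_tautology (by intro t hn hc; simp only [imp, hn, hc]; tauto)
    exact .mp _ _ (.mp _ _ (.prov _ taut) h₁) h₂

theorem Der.exists_of_sUnion {c : Set (Set (Formula Ags P))} (hc : IsChain (· ⊆ ·) c)
    (hne : c.Nonempty) {φ : Formula Ags P} (h : Der (⋃₀ c) φ) : ∃ s ∈ c, Der s φ := by
  induction h with
  | mem φ h =>
    obtain ⟨s, hs, h⟩ := h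
    exact ⟨s, hs, .mem _ h⟩
  | prov φ h =>
    obtain ⟨s, hs⟩ := hne
    exact ⟨s, hs, .prov _ h⟩
  | mp φ ψ _ _ h₁ h₂ =>
    obtain ⟨s, hs, h₁⟩ := h₁
    obtain ⟨s', hs', h₂⟩ := h₂
    rcases hc.total hs hs' with hss | hss
    · exact ⟨s', hs', .mp _ _ (h₁.mono hss) h₂⟩
    · exact ⟨s, hs, .mp _ _ h₁ (h₂.mono hss)⟩

variable (Ags P) in
/-- Maximal `Λ`-consistent sets, described as Boolean valuations that verify all theorems. -/
structure World where
  carrier : Set (Formula Ags P)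
  prov : ∀ φ, Provable φ → φ ∈ carrier
  neg_iff : ∀ φ, neg φ ∈ carrier ↔ φ ∉ carrier
  conj_iff : ∀ φ ψ, conj φ ψ ∈ carrier ↔ φ ∈ carrier ∧ ψ ∈ carrier

instance : Membership (Formula Ags P) (World Ags P) := ⟨fun w φ => φ ∈ w.carrier⟩

namespace World

variable (w : World Ags P)

theorem mem_of_provable {φ : Formula Ags P} (h : Provable φ) : φ ∈ w := w.prov φ h

theorem mem_of_axm {φ : Formula Ags P} (h : Axm φ) : φ ∈ w := w.prov φ (.ax _ h)

theorem neg_mem {φ : Formula Ags P} : neg φ ∈ w ↔ φ ∉ w := w.neg_iff φ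

theorem conj_mem {φ ψ : Formula Ags P} : conj φ ψ ∈ w ↔ φ ∈ w ∧ ψ ∈ w := w.conj_iff φ ψ

theorem imp_mem {φ ψ : Formula Ags P} : imp φ ψ ∈ w ↔ (φ ∈ w → ψ ∈ w) := by
  simp only [imp, neg_mem, conj_mem]; tauto

theorem disj_mem {φ ψ : Formula Ags P} : disj φ ψ ∈ w ↔ φ ∈ w ∨ ψ ∈ w := by
  simp only [disj, neg_mem, conj_mem]; tauto

theorem dia_mem {φ : Formula Ags P} : dia φ ∈ w ↔ box (neg φ) ∉ w := w.neg_mem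

theorem bigConj_mem {φ : Formula Ags P} {l : List (Formula Ags P)} :
    bigConj φ l ∈ w ↔ ∀ ψ ∈ φ :: l, ψ ∈ w := by
  induction l generalizing φ with
  | nil => simp [bigConj]
  | cons ψ l ih => rw [bigConj, conj_mem, ih]; simp

theorem isTheory : IsTheory {φ | φ ∈ w} :=
  ⟨fun _ h => w.mem_of_provable h, fun _ _ h => w.imp_mem.1 h⟩

end World

/-- Lindenbaum's lemma. -/
theorem exists_world_of_not_der {Γ : Set (Formula Ags P)} {φ : Formula Ags P}
    (h : ¬ Der Γ φ) : ∃ w : World Ags P, (∀ ψ ∈ Γ, ψ ∈ w) ∧ φ ∉ w := by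
  obtain ⟨M, hΓM, hM⟩ := zorn_subset_nonempty {Δ | ¬ Der Δ φ}
    (fun c hc hchain hne => ⟨⋃₀ c, fun hd => by
      obtain ⟨s, hs, hd⟩ := Der.exists_of_sUnion hchain hne hd
      exact hc hs hd, fun s hs => Set.subset_sUnion_of_mem hs⟩) Γ h
  have hφ : ¬ Der M φ := hM.prop
  -- `M` is maximal among the sets that do not derive `φ`, so `φ` plays the role of falsum and `imp
  -- ψ φ` that of the negation of `ψ`.
  have himp : ∀ ψ, ψ ∉ M → Der M (imp ψ φ) := by
    intro ψ hψ
    by_contra hd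
    refine hψ (hM.le_of_ge (y := insert ψ M) (fun hd' => hd hd'.deduction)
      (Set.subset_insert _ _) (Set.mem_insert _ _))
  have hth : ∀ ψ, Der M ψ → ψ ∈ M := by
    intro ψ hψ
    by_contra hm
    exact hφ (.mp _ _ (himp ψ hm) hψ)
  have hT : IsTheory M :=
    ⟨fun ψ hψ => hth _ (.prov _ hψ), fun ψ χ h₁ h₂ => hth _ (.mp _ _ (.mem _ h₁) (.mem _ h₂))⟩
  have hφM : φ ∉ M := fun hm => hφ (.mem _ hm)
  refine ⟨⟨M, hT.prov, fun ψ => ⟨fun h₁ h₂ => ?_, fun h₁ => ?_⟩,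
    fun ψ χ => ⟨fun h => ⟨?_, ?_⟩, fun h => ?_⟩⟩, fun ψ hψ => hΓM hψ, hφM⟩
  · have taut : Provable (imp (neg ψ) (imp ψ φ)) :=
      provable_of_tautology (by intro t hn hc; simp only [imp, hn, hc]; tauto)
    exact hφM (hT.mp _ _ (hT.mp _ _ (hT.prov _ taut) h₁) h₂)
  · by_contra h₂
    have taut : Provable (imp (imp ψ φ) (imp (imp (neg ψ) φ) φ)) :=
      provable_of_tautology (by intro t hn hc; simp only [imp, hn, hc]; tauto)
    exact hφM (hT.mp _ _ (hT.mp _ _ (hT.prov _ taut) (hth _ (himp _ h₁))) (hth _ (himp _ h₂)))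
  · have taut : Provable (imp (conj ψ χ) ψ) :=
      provable_of_tautology (by intro t hn hc; simp only [imp, hn, hc]; tauto)
    exact hT.mp _ _ (hT.prov _ taut) h
  · have taut : Provable (imp (conj ψ χ) χ) :=
      provable_of_tautology (by intro t hn hc; simp only [imp, hn, hc]; tauto)
    exact hT.mp _ _ (hT.prov _ taut) h
  · have taut : Provable (imp ψ (imp χ (conj ψ χ))) :=
      provable_of_tautology (by intro t hn hc; simp only [imp, hn, hc]; tauto)
    exact hT.mp _ _ (hT.mp _ _ (hT.prov _ taut) h.1) h.2

theorem exists_world_of_not_provable {φ : Formula Ags P} (h : ¬ Provable φ) :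
    ∃ w : World Ags P, φ ∉ w := by
  have hT : IsTheory {ψ : Formula Ags P | Provable ψ} := ⟨fun _ h => h, Provable.mp⟩
  obtain ⟨w, -, hw⟩ := exists_world_of_not_der (fun hd => h (hT.mem_of_der hd))
  exact ⟨w, hw⟩

theorem IsTheory.exists_world {T : Set (Formula Ags P)} (hT : IsTheory T) {φ : Formula Ags P}
    (h : φ ∉ T) : ∃ w : World Ags P, (∀ ψ ∈ T, ψ ∈ w) ∧ φ ∉ w :=
  exists_world_of_not_der fun hd => h (hT.mem_of_der hd)

/-- Theories are closed under conjunction, so the premises that a derivation takes from `A i` merge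
into one formula `a i`. -/
theorem der_iUnion {ι : Type*} {A : ι → Set (Formula Ags P)} (hA : ∀ i, IsTheory (A i))
    {φ : Formula Ags P} (h : Der (⋃ i, A i) φ) :
    ∃ a : ι → Formula Ags P, (∀ i, a i ∈ A i) ∧
      ∀ w : World Ags P, (∀ i, a i ∈ w) → φ ∈ w := by
  classical
  have conj_mem : ∀ i (ψ χ : Formula Ags P), ψ ∈ A i → χ ∈ A i → conj ψ χ ∈ A i := by
    intro i ψ χ h₁ h₂
    have taut : Provable (imp ψ (imp χ (conj ψ χ))) :=
      provable_of_tautology (by intro t hn hc; simp only [imp, hn, hc]; tauto)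
    exact (hA i).mp _ _ ((hA i).mp _ _ ((hA i).prov _ taut) h₁) h₂
  have top : Provable (imp φ φ) :=
    provable_of_tautology (by intro t hn hc; simp only [imp, hn, hc]; tauto)
  -- `τ` is a fixed theorem, the default for indices that contribute no premise; it must not vary
  -- with `φ` during the induction.
  generalize imp φ φ = τ at top
  induction h with
  | mem φ h =>
    obtain ⟨i, hi⟩ := Set.mem_iUnion.1 h
    refine ⟨Function.update (fun _ => τ) i φ, fun j => ?_, fun w hw => ?_⟩
    · rcases eq_or_ne j i with rfl | hj
      · simpa using hi
      · simpa [hj] using (hA j).prov _ top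
    · simpa using hw i
  | prov φ h => exact ⟨fun _ => τ, fun j => (hA j).prov _ top, fun w _ => w.mem_of_provable h⟩
  | mp φ ψ _ _ h₁ h₂ =>
    obtain ⟨a, ha, h₁⟩ := h₁
    obtain ⟨b, hb, h₂⟩ := h₂
    refine ⟨fun i => conj (a i) (b i), fun i => conj_mem i _ _ (ha i) (hb i), fun w hw => ?_⟩
    exact w.imp_mem.1 (h₁ w fun i => (w.conj_mem.1 (hw i)).1) (h₂ w fun i => (w.conj_mem.1 (hw i)).2)

/-- A family of theories has a common world if every choice of one formula from each does. -/
theorem exists_world_of_theories {ι : Type*} {A : ι → Set (Formula Ags P)}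
    (hA : ∀ i, IsTheory (A i))
    (h : ∀ a : ι → Formula Ags P, (∀ i, a i ∈ A i) → ∃ w : World Ags P, ∀ i, a i ∈ w) :
    ∃ w : World Ags P, ∀ i, ∀ φ ∈ A i, φ ∈ w := by
  -- A contradiction can be written down only if some formula exists; otherwise the empty set is
  -- vacuously a world.
  by_cases hne : Nonempty (Formula Ags P)
  · obtain ⟨φ⟩ := hne
    obtain ⟨w, hw, -⟩ := exists_world_of_not_der (Γ := ⋃ i, A i) (φ := conj φ (neg φ)) (by
      intro hd
      obtain ⟨a, ha, hw⟩ := der_iUnion hA hd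
      obtain ⟨w, hwa⟩ := h a ha
      have := hw w hwa
      rw [w.conj_mem, w.neg_mem] at this
      exact this.2 this.1)
    exact ⟨w, fun i φ hφ => hw φ (Set.mem_iUnion.2 ⟨i, hφ⟩)⟩
  · rw [not_nonempty_iff] at hne
    exact ⟨⟨∅, fun φ => (hne.false φ).elim, fun φ => (hne.false φ).elim,
      fun φ => (hne.false φ).elim⟩, fun i φ => (hne.false φ).elim⟩

theorem exists_world_of_two_theories {A B : Set (Formula Ags P)} (hA : IsTheory A)
    (hB : IsTheory B) (h : ∀ a ∈ A, ∀ b ∈ B, ∃ w : World Ags P, a ∈ w ∧ b ∈ w) :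
    ∃ w : World Ags P, (∀ φ ∈ A, φ ∈ w) ∧ ∀ φ ∈ B, φ ∈ w := by
  obtain ⟨w, hw⟩ := exists_world_of_theories (A := fun b : Bool => cond b A B)
    (by rintro (_ | _) <;> assumption) (fun a ha => by
      obtain ⟨w, h₁, h₂⟩ := h (a true) (ha true) (a false) (ha false)
      exact ⟨w, by rintro (_ | _) <;> assumption⟩)
  exact ⟨w, hw true, hw false⟩

/-! ### Canonical relations -/

/-- The formulas `φ` for which `N φ` holds at `w`. -/
def core (N : Formula Ags P → Formula Ags P) (w : World Ags P) : Set (Formula Ags P) :=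
  {φ | N φ ∈ w}

/-- The canonical accessibility relation of `N`. -/
def rel (N : Formula Ags P → Formula Ags P) (w v : World Ags P) : Prop := ∀ φ, N φ ∈ w → φ ∈ v

/-- Unary operators that satisfy `(K)` and Necessitation. -/
structure IsNormal (N : Formula Ags P → Formula Ags P) : Prop where
  k : ∀ φ ψ, Provable (imp (N (imp φ ψ)) (imp (N φ) (N ψ)))
  nec : ∀ φ, Provable φ → Provable (N φ)

theorem IsNormal.isTheory_core {N : Formula Ags P → Formula Ags P} (hN : IsNormal N)
    (w : World Ags P) : IsTheory (core N w) :=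
  ⟨fun φ h => w.mem_of_provable (hN.nec φ h),
    fun φ ψ h₁ h₂ => w.imp_mem.1 (w.imp_mem.1 (w.mem_of_provable (hN.k φ ψ)) h₁) h₂⟩

theorem IsNormal.exists_rel {N : Formula Ags P → Formula Ags P} (hN : IsNormal N)
    {w : World Ags P} {φ : Formula Ags P} (h : N φ ∉ w) : ∃ v, rel N w v ∧ φ ∉ v :=
  (hN.isTheory_core w).exists_world h

theorem IsNormal.mem_iff {N : Formula Ags P → Formula Ags P} (hN : IsNormal N)
    {w : World Ags P} {φ : Formula Ags P} : N φ ∈ w ↔ ∀ v, rel N w v → φ ∈ v := by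
  refine ⟨fun h v hv => hv φ h, fun h => ?_⟩
  by_contra hφ
  obtain ⟨v, hv, hv'⟩ := hN.exists_rel hφ
  exact hv' (h v hv)

theorem rel_equivalence {N : Formula Ags P → Formula Ags P} (hN : IsNormal N)
    (hS : ∀ φ, S5Axiom N φ → Provable φ) : Equivalence (rel N) where
  refl w φ h := w.imp_mem.1 (w.mem_of_provable (hS _ (.t φ))) h
  symm {w v} h φ hφ := by
    by_contra hw
    -- Axiom (5) is used at `neg φ`, whose dual is `neg (N (neg (neg φ)))`; hence the double
    -- negations.
    have h₁ : N (neg (neg φ)) ∉ w := fun hn => by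
      have := w.imp_mem.1 (w.mem_of_provable (hS _ (.t (neg (neg φ))))) hn
      rw [w.neg_mem, w.neg_mem] at this
      exact this hw
    have h₂ := h _ (w.imp_mem.1 (w.mem_of_provable (hS _ (.five (neg φ)))) (w.neg_mem.2 h₁))
    have taut : Provable (imp φ (neg (neg φ))) :=
      provable_of_tautology (by intro t hn hc; simp only [imp, hn, hc]; tauto)
    exact v.neg_mem.1 h₂ ((hN.isTheory_core v).mp _ _ ((hN.isTheory_core v).prov _ taut) hφ)
  trans {w v u} h₁ h₂ φ hφ :=
    h₂ _ (h₁ _ (w.imp_mem.1 (w.mem_of_provable (hS _ (.four φ))) hφ))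

theorem isNormal_box : IsNormal (box : Formula Ags P → Formula Ags P) :=
  ⟨fun φ ψ => .ax _ (.s5Box _ (.k φ ψ)), .necBox⟩

theorem isNormal_stit (α : Ags) : IsNormal (stit α : Formula Ags P → Formula Ags P) :=
  ⟨fun φ ψ => .ax _ (.s5Stit α _ (.k φ ψ)), .necStit α⟩

theorem isNormal_know (α : Ags) : IsNormal (know α : Formula Ags P → Formula Ags P) :=
  ⟨fun φ ψ => .ax _ (.s5Know α _ (.k φ ψ)), .necKnow α⟩

theorem isNormal_ought (α : Ags) : IsNormal (ought α : Formula Ags P → Formula Ags P) :=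
  ⟨fun φ ψ => .ax _ (.a1 α φ ψ), .necOught α⟩

theorem isNormal_oughtS (α : Ags) : IsNormal (oughtS α : Formula Ags P → Formula Ags P) :=
  ⟨fun φ ψ => .ax _ (.a5 α φ ψ), .necOughtS α⟩

theorem rel_box_equivalence : Equivalence (rel (box : Formula Ags P → Formula Ags P)) :=
  rel_equivalence isNormal_box fun φ h => .ax _ (.s5Box φ h)

theorem rel_stit_equivalence (α : Ags) :
    Equivalence (rel (stit α : Formula Ags P → Formula Ags P)) :=
  rel_equivalence (isNormal_stit α) fun φ h => .ax _ (.s5Stit α φ h)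

theorem rel_know_equivalence (α : Ags) :
    Equivalence (rel (know α : Formula Ags P → Formula Ags P)) :=
  rel_equivalence (isNormal_know α) fun φ h => .ax _ (.s5Know α φ h)

theorem exists_rel_box_of_dia {w : World Ags P} {φ : Formula Ags P} (h : dia φ ∈ w) :
    ∃ v, rel box w v ∧ φ ∈ v := by
  obtain ⟨v, hv, hv'⟩ := isNormal_box.exists_rel (w.dia_mem.1 h)
  rw [v.neg_mem, not_not] at hv'
  exact ⟨v, hv, hv'⟩

theorem dia_of_rel_box {w v : World Ags P} {φ : Formula Ags P} (h : rel box w v) (hφ : φ ∈ v) :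
    dia φ ∈ w :=
  w.dia_mem.2 fun hb => v.neg_mem.1 (h _ hb) hφ

theorem rel_box_of_rel_stit {α : Ags} {w v : World Ags P} (h : rel (stit α) w v) :
    rel box w v := fun φ hφ =>
  h φ (w.conj_mem.1 (w.imp_mem.1 (w.mem_of_axm (.a2 α φ)) hφ)).1

theorem rel_know_of_rel_stit {α : Ags} {w v : World Ags P} (h : rel (stit α) w v) :
    rel (know α) w v := fun φ hφ =>
  h φ (w.imp_mem.1 (w.mem_of_axm (.oac α φ)) hφ)

/-- If `α` knows `b` at `v'`, then `dia (know α b)` holds at `v`; (Unif-H) turns this into knowledge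
of `dia b`, so `b` is possible at `u`. This makes the two cores jointly consistent. -/
theorem rel_unif {α : Ags} {v u v' : World Ags P} (hvu : rel (know α) v u)
    (hv : rel box v v') : ∃ u', rel box u u' ∧ rel (know α) v' u' := by
  obtain ⟨u', h₁, h₂⟩ := exists_world_of_two_theories (isNormal_box.isTheory_core u)
    ((isNormal_know α).isTheory_core v') (by
      intro a ha b hb
      have hd : dia (know α b) ∈ v := dia_of_rel_box hv hb
      obtain ⟨t, ht, hbt⟩ := exists_rel_box_of_dia
        (hvu _ (v.imp_mem.1 (v.mem_of_axm (.unifH α b)) hd))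
      exact ⟨t, ht a ha, hbt⟩)
  exact ⟨u', h₁, h₂⟩

/-- One formula per agent suffices by `exists_world_of_theories`, and (IA), applied to the list of
all agents, realizes them together. -/
theorem rel_indep [Finite Ags] (x : World Ags P) (v : Ags → World Ags P)
    (hv : ∀ α, rel box x (v α)) : ∃ u, ∀ α, rel (stit α) (v α) u := by
  classical
  have := Fintype.ofFinite Ags
  refine exists_world_of_theories (A := fun α => core (stit α) (v α))
    (fun α => (isNormal_stit α).isTheory_core _) fun a ha => ?_
  have hd : ∀ α, dia (stit α (a α)) ∈ x := fun α => dia_of_rel_box (hv α) (ha α)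
  let g : Ags → Ags × Formula Ags P := fun α => (α, a α)
  cases hl : (Finset.univ : Finset Ags).toList with
  | nil =>
    refine ⟨x, fun α => ?_⟩
    have : α ∈ (Finset.univ : Finset Ags).toList := by simp
    simp [hl] at this
  | cons α₀ l =>
    have hnd : ((g α₀ :: l.map g).map Prod.fst).Nodup := by
      have : (g α₀ :: l.map g).map Prod.fst = (Finset.univ : Finset Ags).toList := by
        simp [hl, g, Function.comp_def]
      rw [this]
      exact Finset.nodup_toList _
    have hx := x.imp_mem.1 (x.mem_of_axm (.ia (g α₀) (l.map g) hnd)) (by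
      rw [x.bigConj_mem]
      intro ψ hψ
      simp only [g, List.map_map, List.mem_cons, List.mem_map, Function.comp_apply] at hψ
      rcases hψ with rfl | ⟨α, -, rfl⟩
      exacts [hd _, hd _])
    obtain ⟨y, -, hy⟩ := exists_rel_box_of_dia hx
    rw [y.bigConj_mem] at hy
    refine ⟨y, fun α => (rel_stit_equivalence α).refl y _ (hy _ ?_)⟩
    have hα : α ∈ α₀ :: l := by rw [← hl]; simp
    simp only [g, List.map_map, List.mem_cons, List.mem_map, Function.comp_apply]
    rcases List.mem_cons.1 hα with rfl | hα
    exacts [.inl rfl, .inr ⟨α, hα, rfl⟩]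

/-! ### Deontically ideal worlds -/

/-- (A3) settles obligations on each class. This is why ideality can be tested at a world itself,
without a reference world. -/
theorem ought_mem_iff_of_rel_box {α : Ags} {w v : World Ags P} (h : rel box w v)
    (φ : Formula Ags P) : ought α φ ∈ w ↔ ought α φ ∈ v := by
  have hr := rel_box_equivalence.refl w
  rcases w.disj_mem.1 (w.mem_of_axm (.a3 α φ)) with hb | hb
  · exact iff_of_true (hr _ hb) (h _ hb)
  · exact iff_of_false (w.neg_mem.1 (hr _ hb)) (v.neg_mem.1 (h _ hb))

theorem oughtS_mem_of_rel {α : Ags} {w v u : World Ags P} (h : rel (know α) w v)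
    (h' : rel box v u) {φ : Formula Ags P} (hφ : oughtS α φ ∈ w) : oughtS α φ ∈ u :=
  h' _ (h _ (w.imp_mem.1 (w.mem_of_axm (.cl α φ)) hφ))

theorem oughtS_mem_iff_of_rel_box {α : Ags} {w v : World Ags P} (h : rel box w v)
    (φ : Formula Ags P) : oughtS α φ ∈ w ↔ oughtS α φ ∈ v :=
  ⟨oughtS_mem_of_rel ((rel_know_equivalence α).refl w) h,
    oughtS_mem_of_rel ((rel_know_equivalence α).refl v) (rel_box_equivalence.symm h)⟩

theorem oughtS_mem_iff_of_rel_know {α : Ags} {w v : World Ags P} (h : rel (know α) w v)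
    (φ : Formula Ags P) : oughtS α φ ∈ w ↔ oughtS α φ ∈ v :=
  ⟨oughtS_mem_of_rel h (rel_box_equivalence.refl v),
    oughtS_mem_of_rel ((rel_know_equivalence α).symm h) (rel_box_equivalence.refl w)⟩

/-- The worlds at which all objective obligations of `α` are fulfilled. -/
def idealO (α : Ags) : Set (World Ags P) := {w | rel (ought α) w w}

/-- The worlds at which all subjective obligations of `α` are fulfilled. -/
def idealS (α : Ags) : Set (World Ags P) := {w | rel (oughtS α) w w}

theorem idealO_of_rel_ought {α : Ags} {x v : World Ags P} (h : rel (ought α) x v) :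
    rel box x v ∧ v ∈ idealO α := by
  have hb : rel box x v := fun φ hφ =>
    h φ (x.conj_mem.1 (x.imp_mem.1 (x.mem_of_axm (.a2 α φ)) hφ)).2
  exact ⟨hb, fun φ hφ => h φ ((ought_mem_iff_of_rel_box hb φ).2 hφ)⟩

/-- The successors of `x` under `rel (ought α)` are exactly the ideal worlds of its class. -/
theorem ought_mem_iff {α : Ags} {x : World Ags P} {φ : Formula Ags P} :
    ought α φ ∈ x ↔ ∀ v, rel box x v → v ∈ idealO α → φ ∈ v := by
  rw [(isNormal_ought α).mem_iff]
  refine ⟨fun h v hv hi => h v fun ψ hψ => hi ψ ((ought_mem_iff_of_rel_box hv ψ).1 hψ),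
    fun h v hv => h v (idealO_of_rel_ought hv).1 (idealO_of_rel_ought hv).2⟩

theorem exists_idealO (α : Ags) (x : World Ags P) : ∃ v, rel box x v ∧ v ∈ idealO α := by
  obtain ⟨v, h₁, h₂⟩ := exists_world_of_two_theories (isNormal_box.isTheory_core x)
    ((isNormal_ought α).isTheory_core x) (by
      intro a ha b hb
      obtain ⟨t, ht, hbt⟩ := exists_rel_box_of_dia (x.imp_mem.1 (x.mem_of_axm (.oic α b)) hb)
      exact ⟨t, ht a ha, (rel_stit_equivalence α).refl t b hbt⟩)
  exact ⟨v, idealO_of_rel_ought h₂⟩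

/-- By (A4) an ideal world fulfils its obligations in the form `stit α φ`, which reaches its whole
choice cell. -/
theorem idealO_of_rel_stit {α : Ags} {v u : World Ags P} (h : rel (stit α) v u)
    (hv : v ∈ idealO α) : u ∈ idealO α := fun φ hφ =>
  h φ (hv _ (v.imp_mem.1 (v.mem_of_axm (.a4 α φ))
    ((ought_mem_iff_of_rel_box (rel_box_of_rel_stit h) φ).2 hφ)))

theorem idealS_of_rel_know {α : Ags} {v u : World Ags P} (h : rel (know α) v u)
    (hv : v ∈ idealS α) : u ∈ idealS α := fun φ hφ =>
  h φ (hv _ (v.imp_mem.1 (v.mem_of_axm (.a6 α φ)) ((oughtS_mem_iff_of_rel_know h φ).2 hφ)))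

theorem exists_idealS (α : Ags) (x : World Ags P) : ∃ v, rel box x v ∧ v ∈ idealS α := by
  obtain ⟨v, h₁, h₂⟩ := exists_world_of_two_theories (isNormal_box.isTheory_core x)
    ((isNormal_oughtS α).isTheory_core x) (by
      intro a ha b hb
      obtain ⟨t, ht, hbt⟩ := exists_rel_box_of_dia (x.imp_mem.1 (x.mem_of_axm (.sOic α b)) hb)
      exact ⟨t, ht a ha, (rel_know_equivalence α).refl t b hbt⟩)
  exact ⟨v, h₁, fun φ hφ => h₂ φ ((oughtS_mem_iff_of_rel_box h₁ φ).2 hφ)⟩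

/-- The composite of `rel (know α)` and `rel box` is the canonical relation of the composite
operator. If no `u` realized `a` and `b` together, then `know α (box (neg (box b)))` would hold at
`x`, contradicting `box b` at `v`. -/
theorem exists_rel_know_rel_box {α : Ags} {x v : World Ags P}
    (h : ∀ φ, know α (box φ) ∈ x → φ ∈ v) : ∃ u, rel (know α) x u ∧ rel box u v := by
  obtain ⟨u, h₁, h₂⟩ := exists_world_of_two_theories ((isNormal_know α).isTheory_core x)
    (isNormal_box.isTheory_core v) (by
      intro a ha b hb
      by_contra hc
      have hk : know α (box (neg (box b))) ∈ x := (isNormal_know α).mem_iff.2 fun u hu =>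
        isNormal_box.mem_iff.2 fun t ht => t.neg_mem.2 fun hbt =>
          hc ⟨u, hu a ha, rel_box_equivalence.symm ht b hbt⟩
      exact v.neg_mem.1 (h _ hk) hb)
  exact ⟨u, h₁, rel_box_equivalence.symm h₂⟩

theorem oughtS_mem_iff {α : Ags} {x : World Ags P} {φ : Formula Ags P} :
    oughtS α φ ∈ x ↔ ∀ u v, rel (know α) x u → rel box u v → v ∈ idealS α → φ ∈ v := by
  refine ⟨fun h u v hu hv hi => hi φ (oughtS_mem_of_rel hu hv h), fun h => ?_⟩
  by_contra hn
  obtain ⟨v, hv, hφ⟩ := (isNormal_oughtS α).exists_rel hn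
  -- (s.N) makes every deontic successor reachable by a knowledge step followed by a historical
  -- step, and obligations do not change along either.
  obtain ⟨u, hu, huv⟩ := exists_rel_know_rel_box (α := α) (x := x) (v := v)
    fun ψ hψ => hv ψ (x.imp_mem.1 (x.mem_of_axm (.sN α ψ)) hψ)
  refine hφ (h u v hu huv fun ψ hψ => hv ψ ?_)
  rwa [oughtS_mem_iff_of_rel_know hu, oughtS_mem_iff_of_rel_box huv]

end Syntactic

/-! ### Frames whose values count agents -/

namespace Frame

variable {Ags : Type u} {W : Type w} (F : Frame Ags W) {α : Ags}

theorem mem_state_iff {G : Ags → Set W} (hG : ∀ β v u, F.rChoice β v u → v ∈ G β → u ∈ G β)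
    {y : W} {S : Set W} (hS : S ∈ F.State α y) {v u : W} (hv : v ∈ S) (hu : u ∈ S) {β : Ags}
    (hβ : β ≠ α) : v ∈ G β ↔ u ∈ G β := by
  obtain ⟨s, hs, rfl⟩ := hS
  obtain ⟨z, -, hz⟩ := hs β
  have hv := hv.2 β hβ
  have hu := hu.2 β hβ
  rw [hz] at hv hu
  have hvu := (F.rChoice_equiv β).trans ((F.rChoice_equiv β).symm hv) hu
  exact ⟨hG β _ _ hvu, hG β _ _ ((F.rChoice_equiv β).symm hvu)⟩

/-- Two worlds of one state of `α` lie in the same cell of every other agent, so their counts can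
differ only by `α` itself. -/
theorem ncard_le_iff [Finite Ags] {G : Ags → Set W}
    (hG : ∀ β v u, F.rChoice β v u → v ∈ G β → u ∈ G β)
    {y : W} {S : Set W} (hS : S ∈ F.State α y) {v u : W} (hv : v ∈ S) (hu : u ∈ S) :
    (({β | v ∈ G β}.ncard : ℕ) : ℝ) ≤ ({β | u ∈ G β}.ncard : ℕ) ↔ (v ∈ G α → u ∈ G α) := by
  have iff := fun β hβ => F.mem_state_iff hG hS hv hu (β := β) hβ
  rw [Nat.cast_le]
  refine ⟨fun h hvα => ?_, fun h => Set.ncard_le_ncard (fun β hβ => ?_) (Set.toFinite _)⟩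
  · by_contra huα
    refine absurd h (not_le.2 (Set.ncard_lt_ncard ⟨fun β hβ => ?_, fun hs => huα (hs hvα)⟩
      (Set.toFinite _)))
    have hne : β ≠ α := by rintro rfl; exact huα hβ
    exact (iff β hne).2 hβ
  · by_cases hne : β = α
    · subst hne; exact h hβ
    · exact (iff β hne).1 hβ

/-- Any two actions of an agent share a state. -/
theorem exists_state {x v v' : W} (hv : F.rBox x v) (hv' : F.rBox x v') :
    ∃ S ∈ F.State α x, v ∈ F.cell α v ∩ S ∧ (F.cell α v' ∩ S).Nonempty := by
  classical
  refine ⟨{u | u ∈ F.cls x ∧ ∀ β, β ≠ α → u ∈ F.cell β v},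
    ⟨fun β => F.cell β v, fun β => ⟨v, hv, rfl⟩, rfl⟩,
    ⟨(F.rChoice_equiv α).refl v, hv, fun β _ => (F.rChoice_equiv β).refl v⟩, ?_⟩
  -- Only `α` deviates: it switches to the action of `v'` while the others keep to the actions of
  -- `v`.
  obtain ⟨u, hu⟩ := F.indep x (fun β => F.cell β (if β = α then v' else v)) fun β => by
    by_cases h : β = α
    · exact ⟨v', hv', by simp [h, cell]⟩
    · exact ⟨v, hv, by simp [h, cell]⟩
  rw [Set.mem_iInter] at hu
  have huα : u ∈ F.cell α v' := by simpa using hu α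
  refine ⟨u, huα, F.rBox_equiv.trans hv' (F.rChoice_le α _ _ huα), fun β hβ => ?_⟩
  simpa [hβ] using hu β

/-- In each state the comparison depends only on whether the actions lie in `G α`. Dominance is not
vacuous, since some state meets both actions. -/
theorem domO_iff [Finite Ags] {G : Ags → Set W}
    (hG : ∀ β v u, F.rChoice β v u → v ∈ G β → u ∈ G β)
    (hval : ∀ v, F.valueO v = ({β | v ∈ G β}.ncard : ℕ))
    {x v v' : W} (hv : F.rBox x v) (hv' : F.rBox x v') :
    F.DomO α x (F.cell α v) (F.cell α v') ↔ (v ∈ G α → v' ∈ G α) := by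
  have symm := fun {v u} => (F.rChoice_equiv α).symm (x := v) (y := u)
  refine ⟨fun h hvG => ?_, fun h S hS u hu u' hu' => ?_⟩
  · obtain ⟨S, hS, hvS, u, hu, huS⟩ := F.exists_state (α := α) hv hv'
    have := h S hS v hvS u ⟨hu, huS⟩
    rw [hval, hval, F.ncard_le_iff hG hS hvS.2 huS] at this
    exact hG α _ _ (symm hu) (this hvG)
  · rw [hval, hval, F.ncard_le_iff hG hS hu.2 hu'.2]
    exact fun hG' => hG α _ _ hu'.1 (h (hG α _ _ (symm hu.1) hG'))

theorem eps_of_rChoice {v u : W} (h : F.rChoice α v u) : F.eps α v u :=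
  (F.eps_equiv α).symm (F.oac α v v ((F.eps_equiv α).refl v) u h)

theorem eps_of_mem_cluster {v y u : W} (h : u ∈ F.cluster α (F.cell α v) y) : F.eps α v u := by
  obtain ⟨-, o, ho, hou⟩ := h
  exact (F.eps_equiv α).trans (F.eps_of_rChoice ho) hou

theorem mem_cluster {v y u : W} (hy : F.rBox y u) (h : F.eps α v u) :
    u ∈ F.cluster α (F.cell α v) y :=
  ⟨hy, v, (F.rChoice_equiv α).refl v, h⟩

/-- As for `domO_iff`: clusters stay within an epistemic class, on which `G α` is constant. The
class of `x` itself suffices to detect a failure. -/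
theorem domS_iff [Finite Ags] {G : Ags → Set W}
    (hG : ∀ β v u, F.eps β v u → v ∈ G β → u ∈ G β)
    (hval : ∀ v, F.valueS v = ({β | v ∈ G β}.ncard : ℕ))
    {x v v' : W} (hv : F.rBox x v) (hv' : F.rBox x v') :
    F.DomS α x (F.cell α v) (F.cell α v') ↔ (v ∈ G α → v' ∈ G α) := by
  have symm := fun {v u} => (F.eps_equiv α).symm (x := v) (y := u)
  have hG' : ∀ β v u, F.rChoice β v u → v ∈ G β → u ∈ G β :=
    fun β v u h => hG β v u (F.eps_of_rChoice h)
  refine ⟨fun h hvG => ?_, fun h y _ S hS u hu u' hu' => ?_⟩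
  · obtain ⟨S, hS, hvS, u, hu, huS⟩ := F.exists_state (α := α) hv hv'
    have hxu : F.rBox x u := F.rBox_equiv.trans hv' (F.rChoice_le α _ _ hu)
    have := h x ⟨x, F.rBox_equiv.refl x, x, F.rBox_equiv.refl x, (F.eps_equiv α).refl x⟩ S hS
      v ⟨F.mem_cluster hv ((F.eps_equiv α).refl v), hvS.2⟩
      u ⟨F.mem_cluster hxu (F.eps_of_rChoice hu), huS⟩
    rw [hval, hval, F.ncard_le_iff hG' hS hvS.2 huS] at this
    exact hG α _ _ (symm (F.eps_of_rChoice hu)) (this hvG)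
  · rw [hval, hval, F.ncard_le_iff hG' hS hu.2 hu'.2]
    exact fun hu'' => hG α _ _ (F.eps_of_mem_cluster hu'.1)
      (h (hG α _ _ (symm (F.eps_of_mem_cluster hu.1)) hu''))

end Frame

/-! ### Obligation as truth throughout the ideal actions -/

namespace Model

variable {Ags : Type u} {P : Type v} {W : Type w} (M : Model Ags P W) {α : Ags}

/-- An action inside `G α` is never strictly dominated, so `φ` cannot fail on it. Any other action
is strictly dominated by one inside `G α`, and whatever weakly dominates the latter is again inside
`G α`. -/
theorem sat_ought_iff [Finite Ags] {G : Ags → Set W}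
    (hG : ∀ β v u, M.rChoice β v u → v ∈ G β → u ∈ G β)
    (hval : ∀ v, M.valueO v = ({β | v ∈ G β}.ncard : ℕ))
    (hne : ∀ β x, ∃ v, M.rBox x v ∧ v ∈ G β) {x : W} {φ : Formula Ags P} :
    M.Sat x (ought α φ) ↔ ∀ v, M.rBox x v → v ∈ G α → M.Sat v φ := by
  have dom := fun v v' => M.domO_iff (α := α) hG hval (x := x) (v := v) (v' := v')
  constructor
  · intro h v hv hvG
    by_contra hφ
    obtain ⟨L', hL', ⟨-, hlt⟩, -⟩ := h (M.cell α v) ⟨v, hv, rfl⟩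
      ⟨v, (M.rChoice_equiv α).refl v, hφ⟩
    obtain ⟨v', hv', rfl⟩ := hL'
    exact hlt ((dom v' v hv' hv).2 fun _ => hvG)
  · rintro h L ⟨v, hv, rfl⟩ ⟨u, hu, hφ⟩
    obtain ⟨v', hv', hv'G⟩ := hne α x
    have hvG : v ∉ G α := fun hvG =>
      hφ (h u (M.rBox_equiv.trans hv (M.rChoice_le α _ _ hu)) (hG α _ _ hu hvG))
    refine ⟨M.cell α v', ⟨v', hv', rfl⟩, ⟨(dom v v' hv hv').2 fun _ => hv'G,
      fun hd => hvG ((dom v' v hv' hv).1 hd hv'G)⟩, ?_⟩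
    rintro L'' ⟨t, ht, rfl⟩ hd s hs
    have hd : M.DomO α x (M.cell α v') (M.cell α t) := by
      rcases hd with hd | hd
      · rw [hd]; exact (dom v' v' hv' hv').2 id
      · exact hd
    exact h s (M.rBox_equiv.trans ht (M.rChoice_le α _ _ hs))
      (hG α _ _ hs ((dom v' t hv' ht).1 hd hv'G))

theorem sat_oughtS_iff [Finite Ags] {G : Ags → Set W}
    (hG : ∀ β v u, M.eps β v u → v ∈ G β → u ∈ G β)
    (hval : ∀ v, M.valueS v = ({β | v ∈ G β}.ncard : ℕ))
    (hne : ∀ β x, ∃ v, M.rBox x v ∧ v ∈ G β) {x : W} {φ : Formula Ags P} :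
    M.Sat x (oughtS α φ) ↔
      ∀ u v, M.eps α x u → M.rBox u v → v ∈ G α → M.Sat v φ := by
  have dom := fun v v' => M.domS_iff (α := α) hG hval (x := x) (v := v) (v' := v')
  have symm := fun {v u} => (M.eps_equiv α).symm (x := v) (y := u)
  constructor
  · intro h u v hu huv hvG
    by_contra hφ
    -- Uniformity carries `v` back to some `z` in the class of `x`; the action of `z` is available
    -- there and has `v` in its cluster.
    obtain ⟨z, hz, hvz⟩ := M.unifH α u x
      ⟨u, x, M.rBox_equiv.refl u, M.rBox_equiv.refl x, symm hu⟩ v huv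
    obtain ⟨L', hL', ⟨-, hlt⟩, -⟩ := h (M.cell α z) ⟨z, hz, rfl⟩
      ⟨u, ⟨x, M.rBox_equiv.refl x, u, M.rBox_equiv.refl u, hu⟩, v,
        M.mem_cluster huv (symm hvz), hφ⟩
    obtain ⟨v', hv', rfl⟩ := hL'
    exact hlt ((dom v' z hv' hz).2 fun _ => hG α _ _ hvz hvG)
  · intro h
    -- The clusters of an action inside `G α` stay inside `G α`, and uniformity supplies in the
    -- class of each of their worlds a world that `α` cannot distinguish from `x`.
    have key : ∀ v, M.rBox x v → v ∈ G α → ∀ y, ∀ u ∈ M.cluster α (M.cell α v) y,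
        M.Sat u φ := by
      intro v hv hvG y u hu
      have hvu := M.eps_of_mem_cluster hu
      obtain ⟨z, hz, hxz⟩ := M.unifH α v u
        ⟨v, u, M.rBox_equiv.refl v, M.rBox_equiv.refl u, hvu⟩ x (M.rBox_equiv.symm hv)
      exact h z u hxz (M.rBox_equiv.symm hz) (hG α _ _ hvu hvG)
    rintro L ⟨v, hv, rfl⟩ ⟨y, -, u, hu, hφ⟩
    obtain ⟨v', hv', hv'G⟩ := hne α x
    have hvG : v ∉ G α := fun hvG => hφ (key v hv hvG y u hu)
    refine ⟨M.cell α v', ⟨v', hv', rfl⟩, ⟨(dom v v' hv hv').2 fun _ => hv'G,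
      fun hd => hvG ((dom v' v hv' hv).1 hd hv'G)⟩, ?_⟩
    rintro L'' ⟨t, ht, rfl⟩ hd y _ s hs
    have hd : M.DomS α x (M.cell α v') (M.cell α t) := by
      rcases hd with hd | hd
      · rw [hd]; exact (dom v' v' hv' hv').2 id
      · exact hd
    exact key t ht ((dom v' t hv' ht).1 hd hv'G) y s hs

end Model

/-! ### The canonical model -/

section Canonical

variable {Ags : Type u} {P : Type v}

/-- The canonical model: the value of a world is the number of agents that fulfil all their
obligations there. -/
noncomputable def canonicalModel (Ags : Type u) (P : Type v) [Finite Ags] :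
    Model Ags P (World Ags P) where
  rBox := rel box
  rBox_equiv := rel_box_equivalence
  rChoice α := rel (stit α)
  rChoice_equiv := rel_stit_equivalence
  rChoice_le _ _ _ := rel_box_of_rel_stit
  indep x s hs := by
    choose v hv hs using hs
    obtain ⟨u, hu⟩ := rel_indep x v hv
    exact ⟨u, Set.mem_iInter.2 fun α => by rw [hs α]; exact hu α⟩
  eps α := rel (know α)
  eps_equiv := rel_know_equivalence
  oac α _ _ h _ h' := (rel_know_equivalence α).trans
    ((rel_know_equivalence α).symm (rel_know_of_rel_stit h')) h
  unifH α x y := by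
    rintro ⟨v, u, hv, hu, hvu⟩ v' hv'
    obtain ⟨u', huu', h⟩ := rel_unif hvu
      (rel_box_equivalence.trans (rel_box_equivalence.symm hv) hv')
    exact ⟨u', rel_box_equivalence.trans hu huu', h⟩
  valueO w := ({α | w ∈ idealO α}.ncard : ℕ)
  valueS w := ({α | w ∈ idealS α}.ncard : ℕ)
  val p := {w | atom p ∈ w}

theorem canonicalModel_sat_iff [Finite Ags] (φ : Formula Ags P) (w : World Ags P) :
    (canonicalModel Ags P).Sat w φ ↔ φ ∈ w := by
  induction φ generalizing w with
  | atom p => exact Iff.rfl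
  | neg φ ih => rw [w.neg_mem, ← ih]; rfl
  | conj φ ψ ih₁ ih₂ => rw [w.conj_mem, ← ih₁, ← ih₂]; rfl
  | box φ ih =>
    rw [isNormal_box.mem_iff]
    exact forall₂_congr fun v _ => ih v
  | stit α φ ih =>
    rw [(isNormal_stit α).mem_iff]
    exact forall₂_congr fun v _ => ih v
  | know α φ ih =>
    rw [(isNormal_know α).mem_iff]
    exact forall₂_congr fun v _ => ih v
  | ought α φ ih =>
    -- Both sides become truth at all ideal worlds of the class; (A4) and (Oic) supply the closure
    -- and existence conditions on `idealO`.
    rw [ought_mem_iff, (canonicalModel Ags P).sat_ought_iff (G := idealO)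
      (fun _ _ _ => idealO_of_rel_stit) (fun _ => rfl) exists_idealO]
    exact forall₃_congr fun v _ _ => ih v
  | oughtS α φ ih =>
    rw [oughtS_mem_iff, (canonicalModel Ags P).sat_oughtS_iff (G := idealS)
      (fun _ _ _ => idealS_of_rel_know) (fun _ => rfl) exists_idealS]
    exact forall₅_congr fun _ v _ _ _ => ih v

end Canonical

end Estit

theorem mainTheorem3 {Ags : Type*} {P : Type*} [Finite Ags] [Countable P] :
    (∀ φ : Estit.Formula Ags P, Estit.Valid φ → Estit.Provable φ) ∧
      (∀ φ : Estit.Formula Ags P, Estit.Consistent φ → Estit.Satisfiable φ) := by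
  refine ⟨fun φ hφ => ?_, fun φ hφ => ?_⟩
  · by_contra h
    obtain ⟨w, hw⟩ := Estit.exists_world_of_not_provable h
    exact hw ((Estit.canonicalModel_sat_iff φ w).1 (hφ _ _ w))
  · obtain ⟨w, hw⟩ := Estit.exists_world_of_not_provable hφ
    rw [w.neg_mem, not_not] at hw
    exact ⟨_, _, w, (Estit.canonicalModel_sat_iff φ w).2 hw⟩
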